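/- Let $n,N\ge 0$ be integers, let $\mathbf a_0,\mathbf a_1,\dots,\mathbf a_N\in\mathbb Z^n$, put $\hat{\mathbf a}_j=(1,\mathbf a_j)\in\mathbb Z^{n+1}$, and let $$L_+=\Big\{l=(l_0,\dots,l_N)\in\mathbb Z^{N+1}\ \Big|\ \sum_{j=0}^N l_j\hat{\mathbf a}_j=\mathbf 0,\ l_i\ge 0\text{ for } i=1,\dots,N\Big\}.$$ Consider the series $$\Phi(\lambda)=\sum_{l\in L_+}\frac{(-1)^{l_1+\cdots+l_N}(l_1+\cdots+l_N)!}{l_1!\cdots l_N!}\prod_{i=1}^N\Big(\frac{\lambda_i}{\lambda_0}\Big)^{l_i}.$$ Let $p$ be a prime number and let $\Phi_1(\lambda)$ be the finite subsum of $\Phi(\lambda)$ over the $l\in L_+$ with $l_1+\cdots+l_N\le p-1$. Let $\Omega$ be the completion of an algebraic closure of $\mathbb Q_p$, with its $p$-adic absolute value, and put $$\mathcal D=\{\lambda\in\Omega^{N+1}\mid\lambda_0\ne 0,\ |\lambda_i/\lambda_0|<1\text{ for }i=1,\dots,N\},$$ $$\mathcal D_+=\{\lambda\in\Omega^{N+1}\mid\lambda_0\neq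 0,\ |\lambda_i/\lambda_0|\le 1\text{ for }i=1,\dots,N,\text{ and }|\Phi_1(\lambda)|=1\}.$$ A function on $\mathcal D_+$ is called analytic if it is the uniform limit on $\mathcal D_+$ of a sequence of rational functions, with coefficients in $\Omega$, in the $\lambda_i/\lambda_0$ $(i=1,\dots,N)$ whose denominators have no zero on $\mathcal D_+$. **Theorem 1.4.** Suppose that $\mathbf a_0$ is the unique point of $\mathbb Z^n$ in the relative interior of the convex hull $\Delta$ of $\{\mathbf a_1,\dots,\mathbf a_N\}$, and that $p\ne 2$. Then the series $\Phi(\lambda)$ converges to a nonzero value at every point of $\mathcal D$, one has $\mathcal D\subseteq\mathcal D_+$, and the ratio $\Phi(\lambda)/\Phi(\lambda^p)$, where $\lambda^p=(\lambda_0^p,\dots,\lambda_N^p)$, extends from $\mathcal D$ to an analytic function on $\mathcal D_+$: there is an analytic function $f$ on $\mathcal D_+$ such that $f(\lambda)=\Phi(\lambda)/\Phi(\lambda^p)$ for all $\lambda\in\mathcal D$. -/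

import Mathlib

open Filter Topology
open scoped Nat

namespace AHyp

noncomputable section

/-- `â_j = (1, a_j) ∈ ℤ^{n+1}`. -/
def hat {n N : ℕ} (a : Fin (N + 1) → Fin n → ℤ) (j : Fin (N + 1)) : Fin (n + 1) → ℤ :=
  Fin.cons 1 (a j)

/-- The module `L` of integer relations among `â_0, …, â_N`. -/
def relations {n N : ℕ} (a : Fin (N + 1) → Fin n → ℤ) : Set (Fin (N + 1) → ℤ) :=
  {l | ∑ j, l j • hat a j = 0}

/-- `L_+`: the relations `l` with `l_i ≥ 0` for `i = 1, …, N` (no condition on `l_0`). -/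
def relationsPlus {n N : ℕ} (a : Fin (N + 1) → Fin n → ℤ) : Set (Fin (N + 1) → ℤ) :=
  {l | l ∈ relations a ∧ ∀ i : Fin N, 0 ≤ l i.succ}

/-- The relations `l ∈ L_+` with `l_1 + ⋯ + l_N ≤ p - 1`. -/
def relationsTrunc {n N : ℕ} (a : Fin (N + 1) → Fin n → ℤ) (p : ℕ) : Set (Fin (N + 1) → ℤ) :=
  {l | l ∈ relationsPlus a ∧ ∑ i : Fin N, l i.succ ≤ (p : ℤ) - 1}

/-- The lattice points (elements of `ℤ^n`) in the relative interior of the convex hull `Δ` of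
`a_1, …, a_N`. -/
def interiorLatticePoints {n N : ℕ} (a : Fin (N + 1) → Fin n → ℤ) : Set (Fin n → ℤ) :=
  {u | (fun k => (u k : ℝ)) ∈
    intrinsicInterior ℝ (convexHull ℝ (Set.range fun (i : Fin N) (k : Fin n) => (a i.succ k : ℝ)))}

section Field

variable {K : Type*} [Field K]

/-- The affine coordinates `(λ_1/λ_0, …, λ_N/λ_0)`. -/
def ratios {N : ℕ} (lam : Fin (N + 1) → K) : Fin N → K := fun i => lam i.succ / lam 0

/-- The term
`(-1)^{l_1+⋯+l_N} (l_1+⋯+l_N)! / (l_1! ⋯ l_N!) ∏_{i=1}^N (λ_i/λ_0)^{l_i}`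
of the hypergeometric series; it is only used for `l ∈ L_+`, where `l_1, …, l_N ≥ 0`. -/
def term {N : ℕ} (l : Fin (N + 1) → ℤ) (lam : Fin (N + 1) → K) : K :=
  (-1) ^ (∑ i : Fin N, (l i.succ).toNat) * ((∑ i : Fin N, (l i.succ).toNat)! : K) /
      (∏ i : Fin N, ((l i.succ).toNat ! : K)) *
    ∏ i : Fin N, ratios lam i ^ (l i.succ).toNat

end Field

/-- Each `l ∈ L` satisfies `l_0 = -(l_1 + ⋯ + l_N)`. -/
theorem relations_zero {n N : ℕ} {a : Fin (N + 1) → Fin n → ℤ} {l : Fin (N + 1) → ℤ}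
    (hl : l ∈ relations a) : l 0 = -∑ i : Fin N, l i.succ := by
  have h := congrFun (show ∑ j, l j • hat a j = 0 from hl) 0
  simp only [hat, Finset.sum_apply, Pi.smul_apply, Fin.cons_zero, smul_eq_mul, mul_one,
    Pi.zero_apply, Fin.sum_univ_succ] at h
  linarith

/-- On `L_+` the term takes the usual form
`(-1)^{-l_0} (-l_0)! / (l_1! ⋯ l_N!) ∏_{i=0}^N λ_i^{l_i}` of an `A`-hypergeometric series. -/
theorem term_eq {K : Type*} [Field K] {n N : ℕ} {a : Fin (N + 1) → Fin n → ℤ}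
    {l : Fin (N + 1) → ℤ} (hl : l ∈ relationsPlus a) {lam : Fin (N + 1) → K} :
    term l lam = (-1) ^ (-l 0) * ((-l 0).toNat ! : K) / (∏ i : Fin N, ((l i.succ).toNat ! : K)) *
      ∏ i, lam i ^ l i := by
  obtain ⟨hl, hpos⟩ := hl
  have hc : ∀ i : Fin N, (((l i.succ).toNat : ℕ) : ℤ) = l i.succ := fun i =>
    Int.toNat_of_nonneg (hpos i)
  have hs : -l 0 = ((∑ i : Fin N, (l i.succ).toNat : ℕ) : ℤ) := by
    rw [relations_zero hl, neg_neg, Nat.cast_sum]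
    exact Finset.sum_congr rfl fun i _ => (hc i).symm
  have h0' : l 0 = -((∑ i : Fin N, (l i.succ).toNat : ℕ) : ℤ) := by omega
  have hprod : ∏ i : Fin N, ratios lam i ^ (l i.succ).toNat = ∏ i, lam i ^ l i := by
    rw [Fin.prod_univ_succ, h0', zpow_neg, zpow_natCast, ← Finset.prod_pow_eq_pow_sum,
      ← Finset.prod_inv_distrib, ← Finset.prod_mul_distrib]
    refine Finset.prod_congr rfl fun i _ => ?_
    have hz : lam i.succ ^ l i.succ = lam i.succ ^ (l i.succ).toNat := by
      rw [← zpow_natCast, hc i]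
    rw [hz, ratios, div_pow, div_eq_mul_inv, mul_comm]
  rw [hs, Int.toNat_natCast, zpow_natCast, ← hprod, term]

/-- The truncated index set is finite, so the sum `PhiOne` below is a genuine finite sum. -/
theorem relationsTrunc_finite {n N : ℕ} (a : Fin (N + 1) → Fin n → ℤ) (p : ℕ) :
    (relationsTrunc a p).Finite := by
  refine (Set.finite_Icc (fun _ => -(p : ℤ)) (fun _ : Fin (N + 1) => (p : ℤ))).subset ?_
  rintro l ⟨⟨hl, hpos⟩, hle⟩
  have h0 := relations_zero hl
  have hs : 0 ≤ ∑ i : Fin N, l i.succ := Finset.sum_nonneg fun i _ => hpos i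
  have hi : ∀ i : Fin N, l i.succ ≤ ∑ i : Fin N, l i.succ := fun i =>
    Finset.single_le_sum (f := fun i : Fin N => l i.succ) (fun j _ => hpos j) (Finset.mem_univ i)
  refine ⟨fun i => ?_, fun i => ?_⟩ <;> refine Fin.cases ?_ (fun i => ?_) i
  · show -(p : ℤ) ≤ l 0
    omega
  · show -(p : ℤ) ≤ l i.succ
    have := hpos i
    omega
  · show l 0 ≤ (p : ℤ)
    omega
  · show l i.succ ≤ (p : ℤ)
    have := hi i
    omega

section Padic

variable (p : ℕ) [Fact p.Prime] {n N : ℕ} (a : Fin (N + 1) → Fin n → ℤ)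

/-- The `A`-hypergeometric series `Φ(λ) = ∑_{l ∈ L_+} term l λ`, summed in `ℂ_[p]`. -/
def Phi (lam : Fin (N + 1) → ℂ_[p]) : ℂ_[p] := ∑' l : relationsPlus a, term l.1 lam

/-- The truncation `Φ₁` of `Φ` to total degree `l_1 + ⋯ + l_N ≤ p - 1`. -/
def PhiOne (lam : Fin (N + 1) → ℂ_[p]) : ℂ_[p] := ∑ᶠ l ∈ relationsTrunc a p, term l lam

/-- `𝒟`: the set where `|λ_i/λ_0| < 1` for `i = 1, …, N` (with `λ_0 ≠ 0`, so that the ratios make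
sense). -/
def domD (N : ℕ) : Set (Fin (N + 1) → ℂ_[p]) := {lam | lam 0 ≠ 0 ∧ ∀ i, ‖ratios lam i‖ < 1}

/-- `𝒟₊`: the set where `|λ_i/λ_0| ≤ 1` for `i = 1, …, N` and `|Φ₁(λ)| = 1` (with `λ_0 ≠ 0`). -/
def domDPlus : Set (Fin (N + 1) → ℂ_[p]) :=
  {lam | lam 0 ≠ 0 ∧ (∀ i, ‖ratios lam i‖ ≤ 1) ∧ ‖PhiOne p a lam‖ = 1}

/-- `f` is analytic on `U`: it is the uniform limit on `U` of a sequence of rational functions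
`P_k/Q_k` in the `λ_i/λ_0` that are defined on `U`, i.e. whose denominators have no zero on `U`. -/
def IsAnalytic (f : (Fin (N + 1) → ℂ_[p]) → ℂ_[p]) (U : Set (Fin (N + 1) → ℂ_[p])) : Prop :=
  ∃ P Q : ℕ → MvPolynomial (Fin N) ℂ_[p],
    (∀ k, ∀ lam ∈ U, MvPolynomial.eval (ratios lam) (Q k) ≠ 0) ∧
    TendstoUniformlyOn
      (fun k lam => MvPolynomial.eval (ratios lam) (P k) / MvPolynomial.eval (ratios lam) (Q k))
      f atTop U

end Padic

end

end AHyp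

/-!
Put `X_i = λ_i / λ_0` and `h = -(X_1 + ⋯ + X_N)`, and give `X_i` the weight `a_i - a_0`. By the
multinomial theorem `Φ` is the weight zero part of `∑_k h^k`, its terms of total degree less than
`m` form the weight zero part `truncation w m` of `∑_{k < m} h^k`, and `Φ₁` is the truncation with
`m = p`. With `F_s` the truncation for `m = p^s`, and with `τ` the substitution `X_i ↦ X_i^p`, the
ratio `Φ(λ) / Φ(λ^p)` is the limit of `F_{s+1} / τ(F_s)` on `𝒟`. Everything follows from
the Dwork congruences
  `F_{s+1} τ(F_t) ≡ F_{t+1} τ(F_s)  mod p^{min(s,t)+1}`,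
`pow_dvd_dworkMinor_truncation`: with `t = 0` they show that `|τ(F_s)| = 1` wherever `|Φ₁| = 1`, and
then that the quotients `F_{s+1} / τ(F_s)` are uniformly Cauchy on `𝒟₊`.

The congruences are first proved for the full geometric sums `H_s = ∑_{k < p^s} h^k`. Here
`H_{s+1} = H_s E_s` with `E_s = ∑_{d < p} h^{d p^s}`, and `E_{s+1} ≡ τ(E_s) mod p^{s+1}` because `τ`
lifts Frobenius (`pow_dvd_dworkMinor_of_mul`). To pass from `H_s` to its weight zero part `F_s`,
define `q_r` by `H_{s+1} = ∑_{r ≤ s} H_{s-r} τ^{s-r}(q_r)`. For any sequence so generated, the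
Dwork congruences follow from `p^r ∣ q_r`, and they imply it if the terms are prime to `p`
(`IsGeneratedBy.pow_dvd_dworkMinor`, `IsGeneratedBy.pow_dvd_of_dworkMinor`). So `p^r ∣ q_r`, and it
is enough that `F_s` is generated by the weight zero parts of the `q_r`.

This holds because taking weight zero parts commutes with products `u · τ^k(v)` for `u` of degree
less than `p^k` (`weightZero_mul_expand`), and it is here that the convexity hypothesis enters: if
the weight of a monomial of degree less than `p^k` is `p^k` times a lattice vector `b`, then
`a_0 + b` lies in the relative interior of `Δ`, so that `b = 0`
(`weightSparse_of_interiorLatticePoints`).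
-/

namespace AHyp

/-! ### Dwork minors of a sequence -/

section Minor

variable {R : Type*} [CommRing R] (τ : R →+* R)

/-- The `2 × 2` minor `F_{s+1} τ(F_t) - F_{t+1} τ(F_s)`, the numerator of the difference of the two
ratios `F_{s+1} / τ(F_s)` and `F_{t+1} / τ(F_t)`. -/
def dworkMinor (F : ℕ → R) (s t : ℕ) : R := F (s + 1) * τ (F t) - F (t + 1) * τ (F s)

theorem dworkMinor_self (F : ℕ → R) (s : ℕ) : dworkMinor τ F s s = 0 := sub_self _

theorem dworkMinor_swap (F : ℕ → R) (s t : ℕ) : dworkMinor τ F s t = -dworkMinor τ F t s := by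
  simp only [dworkMinor, neg_sub]

/-- `F` is generated by `q` if `F_0 = 1` and `F_{s+1} = ∑_{r ≤ s} F_{s-r} τ^{s-r}(q_r)`; that is,
`F = 1 + F q T` as power series in a variable `T` subject to `T c = τ(c) T`, where
`F = ∑ F_s T^s` and `q = ∑ q_r T^r`. -/
def IsGeneratedBy (F q : ℕ → R) : Prop :=
  F 0 = 1 ∧ ∀ s, F (s + 1) = ∑ r ∈ Finset.range (s + 1), F (s - r) * τ^[s - r] (q r)

/-- The generating sequence, obtained by solving the recursion for its last term. -/
def generator (F : ℕ → R) : ℕ → R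
  | s => F (s + 1) - ∑ r : Fin s, F (s - r) * τ^[s - r] (generator F r)

theorem isGeneratedBy_generator {F : ℕ → R} (h0 : F 0 = 1) :
    IsGeneratedBy τ F (generator τ F) := by
  refine ⟨h0, fun s => ?_⟩
  rw [Finset.sum_range_succ, Finset.sum_range, generator.eq_def τ F s]
  simp [h0]

variable {τ}

theorem IsGeneratedBy.dworkMinor_succ {F q : ℕ → R} (h : IsGeneratedBy τ F q) (s t : ℕ) :
    dworkMinor τ F (s + 1) t =
      ∑ r ∈ Finset.range (s + 1), τ^[s + 1 - r] (q r) * dworkMinor τ F (s - r) t +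
        q (s + 1) * τ (F t) := by
  have h1 : τ (F (s + 1)) =
      ∑ r ∈ Finset.range (s + 1), τ (F (s - r)) * τ^[s + 1 - r] (q r) := by
    rw [h.2 s, map_sum]
    refine Finset.sum_congr rfl fun r hr => ?_
    rw [map_mul, Nat.succ_sub (Finset.mem_range_succ_iff.1 hr), Function.iterate_succ_apply']
  have h2 : F (s + 1 + 1) = ∑ r ∈ Finset.range (s + 1), F (s - r + 1) * τ^[s + 1 - r] (q r) +
      q (s + 1) := by
    rw [h.2 (s + 1), Finset.sum_range_succ, Nat.sub_self, h.1, one_mul, Function.iterate_zero_apply]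
    congr 1
    refine Finset.sum_congr rfl fun r hr => ?_
    rw [Nat.succ_sub (Finset.mem_range_succ_iff.1 hr)]
  rw [dworkMinor, h1, h2, add_mul, Finset.sum_mul, Finset.mul_sum, add_sub_right_comm,
    ← Finset.sum_sub_distrib]
  congr 1
  refine Finset.sum_congr rfl fun r _ => ?_
  rw [dworkMinor]
  ring

variable {P : R}

theorem pow_dvd_iterate (hP : τ P = P) {k : ℕ} {x : R} (h : P ^ k ∣ x) (m : ℕ) :
    P ^ k ∣ τ^[m] x := by
  induction m with
  | zero => exact h
  | succ m ih =>
    rw [Function.iterate_succ_apply']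
    simpa [hP] using map_dvd τ ih

/-- A generator divisible by increasing powers of `P` forces the Dwork congruences. -/
theorem IsGeneratedBy.pow_dvd_dworkMinor {F q : ℕ → R} (h : IsGeneratedBy τ F q) (hP : τ P = P)
    (hq : ∀ r, P ^ r ∣ q r) (s t : ℕ) : P ^ (min s t + 1) ∣ dworkMinor τ F s t := by
  induction hn : s + t using Nat.strong_induction_on generalizing s t with
  | _ n ih =>
  subst hn
  wlog hst : t < s generalizing s t
  · rcases (not_lt.1 hst).eq_or_lt with rfl | hlt
    · simp [dworkMinor_self]
    · rw [dworkMinor_swap, dvd_neg, min_comm]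
      exact this t s (fun m hm s t => ih m (by omega) s t) hlt
  obtain ⟨s, rfl⟩ : ∃ s', s = s' + 1 := ⟨s - 1, by omega⟩
  rw [h.dworkMinor_succ]
  refine dvd_add (Finset.dvd_sum fun r hr => ?_) (Dvd.dvd.mul_right
    ((pow_dvd_pow P (by omega)).trans (hq (s + 1))) _)
  have hr := Finset.mem_range_succ_iff.1 hr
  refine (pow_dvd_pow P (n := r + (min (s - r) t + 1)) (by omega)).trans ?_
  rw [pow_add]
  exact mul_dvd_mul (pow_dvd_iterate hP (hq r) _) (ih _ (by omega) _ _ rfl)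

/-- Conversely, the Dwork congruences force the divisibility of the generator, as soon as the
terms are prime to `P`. -/
theorem IsGeneratedBy.pow_dvd_of_dworkMinor [IsDomain R] {F q : ℕ → R} (h : IsGeneratedBy τ F q)
    (hP : τ P = P) (hprime : Prime P) (hF : ∀ s, ¬ P ∣ τ (F s))
    (hD : ∀ s t, P ^ (min s t + 1) ∣ dworkMinor τ F s t) (s : ℕ) : P ^ s ∣ q s := by
  induction s using Nat.strong_induction_on with
  | _ s ih =>
  obtain _ | s := s
  · simp
  -- Expanding the vanishing minor with equal indices isolates `q (s + 1) * τ (F (s + 1))`.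
  refine hprime.pow_dvd_of_dvd_mul_right _ (hF (s + 1)) ?_
  have h0 := h.dworkMinor_succ s (s + 1)
  rw [dworkMinor_self, eq_comm, add_comm, add_eq_zero_iff_eq_neg] at h0
  rw [h0, dvd_neg]
  refine Finset.dvd_sum fun r hr => ?_
  have hr := Finset.mem_range_succ_iff.1 hr
  refine (pow_dvd_pow P (n := r + (min (s - r) (s + 1) + 1)) (by omega)).trans ?_
  rw [pow_add]
  exact mul_dvd_mul (pow_dvd_iterate hP (ih r (by omega)) _) (hD _ _)

/-- The Dwork congruences for a sequence of products `E_0 ⋯ E_{s-1}`. -/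
theorem pow_dvd_dworkMinor_of_mul {F E : ℕ → R} (hF : ∀ s, F (s + 1) = F s * E s)
    (hE : ∀ j, P ^ (j + 1) ∣ E (j + 1) - τ (E j)) (s t : ℕ) :
    P ^ (min s t + 1) ∣ dworkMinor τ F s t := by
  wlog hst : t ≤ s generalizing s t
  · rw [dworkMinor_swap, dvd_neg, min_comm]
    exact this t s (by omega)
  rw [min_eq_right hst]
  induction s, hst using Nat.le_induction with
  | base => simp [dworkMinor_self]
  | succ s hs ih =>
    have : dworkMinor τ F (s + 1) t =
        E (s + 1) * dworkMinor τ F s t + F (t + 1) * τ (F s) * (E (s + 1) - τ (E s)) := by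
      rw [dworkMinor, dworkMinor, hF (s + 1), hF s, map_mul]
      ring
    rw [this]
    exact dvd_add (ih.mul_left _) (((pow_dvd_pow P (by omega)).trans (hE s)).mul_left _)

end Minor

/-! ### Truncated geometric series in integral polynomials -/

section Polynomial

open MvPolynomial

variable {σ : Type*} (p : ℕ)

theorem natCast_dvd_expand_sub_pow [Fact p.Prime] (g : MvPolynomial σ ℤ) :
    (p : MvPolynomial σ ℤ) ∣ expand p g - g ^ p := by
  have : (p : MvPolynomial σ ℤ) = C (p : ℤ) := by simp
  rw [this, C_dvd_iff_zmod, map_sub, map_expand, expand_zmod, map_pow, sub_self]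

theorem geom_sum_mul_geom_sum {R : Type*} [CommRing R] (h : R) (m d : ℕ) :
    ∑ k ∈ Finset.range (m * d), h ^ k =
      (∑ k ∈ Finset.range m, h ^ k) * ∑ k ∈ Finset.range d, h ^ (m * k) := by
  induction d with
  | zero => simp
  | succ d ih =>
    rw [Nat.mul_succ, Finset.sum_range_add, ih, Finset.sum_range_succ, mul_add]
    congr 1
    rw [Finset.sum_mul]
    exact Finset.sum_congr rfl fun k _ => by rw [pow_add, mul_comm]

/-- The Dwork congruences before taking parts of weight zero: `expand p` lifts Frobenius, so the
ratios of consecutive sums are compatible with it to increasing powers of `p`. -/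
theorem pow_dvd_dworkMinor_geom_sum [Fact p.Prime] (h : MvPolynomial σ ℤ) (s t : ℕ) :
    (p : MvPolynomial σ ℤ) ^ (min s t + 1) ∣
      dworkMinor (expand p : MvPolynomial σ ℤ →ₐ[ℤ] _).toRingHom
        (fun s => ∑ k ∈ Finset.range (p ^ s), h ^ k) s t := by
  refine pow_dvd_dworkMinor_of_mul (E := fun j => ∑ d ∈ Finset.range p, h ^ (p ^ j * d))
    (fun s => ?_) (fun j => ?_) s t
  · rw [pow_succ, geom_sum_mul_geom_sum]
  · rw [map_sum, ← Finset.sum_sub_distrib]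
    refine Finset.dvd_sum fun d _ => ?_
    have := dvd_sub_pow_of_dvd_sub (natCast_dvd_expand_sub_pow p (h ^ d)) j
    rw [← dvd_neg, neg_sub]
    convert! this using 2
    · simp [← map_pow, ← pow_mul, mul_comm]
    · rw [← pow_mul, ← pow_mul]
      congr 1
      ring

theorem iterate_expand (k : ℕ) (g : MvPolynomial σ ℤ) :
    (expand p : MvPolynomial σ ℤ →ₐ[ℤ] _).toRingHom^[k] g = expand (p ^ k) g := by
  induction k with
  | zero => simp
  | succ k ih =>
    rw [Function.iterate_succ_apply', ih, pow_succ', expand_mul]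
    rfl

/-! ### The constant term with respect to a weight -/

variable {M : Type*} [AddCommGroup M] (w : σ → M)

/-- A weight without small relations modulo `m`: no exponent of total degree less than `m` has
weight `m u` with `u ≠ 0`. -/
def WeightSparse (m : ℕ) : Prop :=
  ∀ d : σ →₀ ℕ, d.degree < m → ∀ u : M, Finsupp.weight w d = m • u → u = 0

variable {w}

theorem weightedHomogeneousComponent_monomial (d : σ →₀ ℕ) (c : ℤ)
    [Decidable (Finsupp.weight w d = 0)] :
    weightedHomogeneousComponent w 0 (monomial d c) =
      if Finsupp.weight w d = 0 then monomial d c else 0 := by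
  have h := isWeightedHomogeneous_monomial w d c rfl
  split_ifs with hd
  · exact (hd ▸ h).weightedHomogeneousComponent_same
  · exact h.weightedHomogeneousComponent_ne 0 (Ne.symm hd)

/-- For `u` of degree less than `m`, the part of weight zero is multiplicative on `u(X) v(X^m)`: in
a monomial of weight zero of this product, the factor from `u` has its weight in `m M`, hence
zero. -/
theorem weightZero_mul_expand {m : ℕ} (hw : WeightSparse w m)
    {u : MvPolynomial σ ℤ} (hu : u.totalDegree < m) (v : MvPolynomial σ ℤ) :
    weightedHomogeneousComponent w 0 (u * expand m v) =
      weightedHomogeneousComponent w 0 u * expand m (weightedHomogeneousComponent w 0 v) := by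
  classical
  induction v using MvPolynomial.induction_on' with
  | add v₁ v₂ h₁ h₂ => simp only [map_add, mul_add, h₁, h₂]
  | monomial e b =>
  rw [u.as_sum, Finset.sum_mul, map_sum, map_sum, Finset.sum_mul]
  refine Finset.sum_congr rfl fun d hd => ?_
  have hdeg : d.degree < m := (le_totalDegree hd).trans_lt hu
  simp only [expand_monomial, monomial_mul, weightedHomogeneousComponent_monomial]
  have hiff : Finsupp.weight w (d + m • e) = 0 ↔
      Finsupp.weight w d = 0 ∧ Finsupp.weight w e = 0 := by
    rw [map_add, map_nsmul]
    refine ⟨fun h => ?_, fun h => by simp [h.1, h.2]⟩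
    have h0 := hw d hdeg (-Finsupp.weight w e) (by rw [smul_neg, eq_neg_iff_add_eq_zero, h])
    rw [neg_eq_zero] at h0
    rw [h0, smul_zero, add_zero] at h
    exact ⟨h, h0⟩
  rw [if_congr hiff rfl rfl]
  by_cases h1 : Finsupp.weight w d = 0 <;> by_cases h2 : Finsupp.weight w e = 0 <;>
    simp [h1, h2, monomial_mul]

variable (w) [Fintype σ]

/-- The constant term, with respect to the weight `w`, of the truncated geometric series
`∑_{k < m} (-∑ᵢ Xᵢ)^k`. With `w i = a_i - a_0` this is the truncation of the hypergeometric series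
to total degree less than `m`, as a polynomial in the ratios `λ_i / λ_0`. -/
noncomputable def truncation (m : ℕ) : MvPolynomial σ ℤ :=
  weightedHomogeneousComponent w 0 (∑ k ∈ Finset.range m, (∑ i, (-1 : ℤ) • X i) ^ k)

theorem totalDegree_geom_sum_lt {m : ℕ} (hm : m ≠ 0) :
    (∑ k ∈ Finset.range m, (∑ i : σ, (-1 : ℤ) • X i : MvPolynomial σ ℤ) ^ k).totalDegree < m := by
  have h1 : (∑ i : σ, (-1 : ℤ) • X i : MvPolynomial σ ℤ).totalDegree ≤ 1 :=
    totalDegree_finsetSum_le fun i _ => (totalDegree_smul_le _ _).trans (totalDegree_X i).le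
  refine (totalDegree_finsetSum_le (d := m - 1) fun k hk => ?_).trans_lt (by omega)
  have hk := Finset.mem_range.1 hk
  exact (totalDegree_pow _ _).trans ((Nat.mul_le_mul_left k h1).trans (by omega))

theorem constantCoeff_geom_sum {m : ℕ} (hm : m ≠ 0) :
    constantCoeff (∑ k ∈ Finset.range m, (∑ i : σ, (-1 : ℤ) • X i : MvPolynomial σ ℤ) ^ k) = 1 := by
  obtain ⟨m, rfl⟩ := Nat.exists_eq_succ_of_ne_zero hm
  rw [Finset.sum_range_succ', map_add, map_sum, Finset.sum_eq_zero]
  · simp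
  · simp [constantCoeff_X]

theorem truncation_one : truncation w 1 = 1 := by
  classical
  rw [truncation, Finset.sum_range_one, pow_zero, ← C_1, ← monomial_zero',
    weightedHomogeneousComponent_monomial, if_pos (map_zero _)]

theorem constantCoeff_truncation {m : ℕ} (hm : m ≠ 0) : constantCoeff (truncation w m) = 1 := by
  classical
  rw [truncation, constantCoeff_eq, coeff_weightedHomogeneousComponent, if_pos (map_zero _),
    ← constantCoeff_eq, constantCoeff_geom_sum hm]

variable {w}

/-- The Dwork congruences for the truncations: the generator of the geometric sums satisfies the
required divisibilities, and its constant term generates the sequence of truncations. -/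
theorem pow_dvd_dworkMinor_truncation [Fact p.Prime] (hw : ∀ k, WeightSparse w (p ^ k)) (s t : ℕ) :
    (p : MvPolynomial σ ℤ) ^ (min s t + 1) ∣
      dworkMinor (expand p : MvPolynomial σ ℤ →ₐ[ℤ] _).toRingHom (fun s => truncation w (p ^ s))
        s t := by
  have hp0 : ∀ k, p ^ k ≠ 0 := fun k => pow_ne_zero k (Fact.out : p.Prime).ne_zero
  set τ := (expand p : MvPolynomial σ ℤ →ₐ[ℤ] _).toRingHom
  set H : ℕ → MvPolynomial σ ℤ :=
    fun s => ∑ k ∈ Finset.range (p ^ s), (∑ i, (-1 : ℤ) • X i) ^ k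
  have hτ : τ (p : MvPolynomial σ ℤ) = p := map_natCast _ _
  have hgen : IsGeneratedBy τ H (generator τ H) := isGeneratedBy_generator τ (by simp [H])
  have hC : (p : MvPolynomial σ ℤ) = C (p : ℤ) := by simp
  have hprime : Prime (p : MvPolynomial σ ℤ) := by
    rw [hC, MvPolynomial.prime_C_iff]
    exact Nat.prime_iff_prime_int.1 Fact.out
  have hH : ∀ s, ¬ (p : MvPolynomial σ ℤ) ∣ τ (H s) := by
    intro s hs
    have h1 := map_dvd constantCoeff hs
    have h2 : constantCoeff (τ (H s)) = 1 := by
      rw [← constantCoeff_geom_sum (σ := σ) (hp0 s)]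
      exact coeff_expand_zero p (Fact.out : p.Prime).ne_zero _
    rw [h2, map_natCast] at h1
    exact (Nat.prime_iff_prime_int.1 (Fact.out : p.Prime)).not_dvd_one h1
  have hq := hgen.pow_dvd_of_dworkMinor hτ hprime hH (pow_dvd_dworkMinor_geom_sum p _)
  refine IsGeneratedBy.pow_dvd_dworkMinor
    (q := fun r => weightedHomogeneousComponent w 0 (generator τ H r)) ⟨?_, fun s => ?_⟩ hτ
    (fun r => ?_) s t
  · rw [pow_zero, truncation_one]
  · have : truncation w (p ^ (s + 1)) = weightedHomogeneousComponent w 0 (H (s + 1)) := rfl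
    rw [this, hgen.2 s, map_sum]
    refine Finset.sum_congr rfl fun r _ => ?_
    rw [iterate_expand, iterate_expand,
      weightZero_mul_expand (hw _) (totalDegree_geom_sum_lt (hp0 _))]
    rfl
  · obtain ⟨g, hg⟩ := hq r
    refine ⟨weightedHomogeneousComponent w 0 g, ?_⟩
    rw [hg, hC, ← map_pow, weightedHomogeneousComponent_C_mul]

theorem coeff_truncation [DecidableEq M] (m : ℕ) (d : σ →₀ ℕ) :
    coeff d (truncation w m) =
      if Finsupp.weight w d = 0 ∧ d.degree < m then (-1) ^ d.degree * (d.multinomial : ℤ) else 0 := by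
  have hd : (d.sum fun _ k => k) = d.degree := rfl
  have h : coeff d (∑ k ∈ Finset.range m, (∑ i : σ, (-1 : ℤ) • X i : MvPolynomial σ ℤ) ^ k) =
      if d.degree < m then (-1) ^ d.degree * (d.multinomial : ℤ) else 0 := by
    simp only [coeff_sum, coeff_linearCombination_X_pow_of_fintype (fun _ : σ => (-1 : ℤ)), hd,
      Finset.sum_ite_eq, Finset.mem_range]
    congr 1
    rw [mul_comm, Finsupp.prod, Finset.prod_pow_eq_pow_sum]
    rfl
  rw [truncation, coeff_weightedHomogeneousComponent, h, ite_and]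

end Polynomial
/-! ### Lattice points in the relative interior -/

/-- A half-open segment from a relative interior point into a convex set lies in the relative
interior: the homothety centred at the far end carries a neighbourhood along. -/
theorem homothety_mem_intrinsicInterior {E : Type*} [NormedAddCommGroup E] [NormedSpace ℝ E]
    {S : Set E} (hS : Convex ℝ S) {x y : E} (hx : x ∈ intrinsicInterior ℝ S) (hy : y ∈ S) {r : ℝ}
    (h0 : 0 < r) (h1 : r ≤ 1) : AffineMap.homothety y r x ∈ intrinsicInterior ℝ S := by
  obtain ⟨x, hx, rfl⟩ := hx
  let y' : affineSpan ℝ S := ⟨y, subset_affineSpan ℝ S hy⟩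
  have : Nonempty (affineSpan ℝ S) := ⟨y'⟩
  have hcoe : ∀ z : affineSpan ℝ S,
      ((AffineMap.homothety y' r z : affineSpan ℝ S) : E) = AffineMap.homothety y r (z : E) := by
    intro z
    simp [AffineMap.homothety_apply, y']
  refine ⟨AffineMap.homothety y' r x, ?_, hcoe x⟩
  have hopen : IsOpen (AffineMap.homothety y' r '' interior ((↑) ⁻¹' S : Set (affineSpan ℝ S))) :=
    AffineMap.homothety_isOpenMap y' r h0.ne' _ isOpen_interior
  refine interior_maximal ?_ hopen ⟨x, hx, rfl⟩
  rintro _ ⟨z, hz, rfl⟩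
  rw [Set.mem_preimage, hcoe, AffineMap.homothety_eq_lineMap]
  exact hS.lineMap_mem hy (interior_subset (s := ((↑) ⁻¹' S : Set (affineSpan ℝ S))) hz) ⟨h0.le, h1⟩

/-- If `a_0` is the only lattice point in the relative interior of the hull of the `a_i`, then no
combination of fewer than `m` of the vectors `a_i - a_0` is a nonzero multiple `m u`: otherwise
`a_0 + u` would be another such point. -/
theorem weightSparse_of_interiorLatticePoints {n N : ℕ} {a : Fin (N + 1) → Fin n → ℤ}
    (ha : interiorLatticePoints a = {a 0}) (m : ℕ) :
    WeightSparse (fun i : Fin N => a i.succ - a 0) m := by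
  intro d hd u hu
  have hm : 0 < m := by omega
  rcases Nat.eq_zero_or_pos d.degree with hd0 | hd0
  · rw [(Finsupp.degree_eq_zero_iff d).1 hd0, map_zero] at hu
    exact (smul_eq_zero.1 hu.symm).resolve_left hm.ne'
  have hmem : a 0 ∈ interiorLatticePoints a := ha ▸ rfl
  have hmR : (m : ℝ) ≠ 0 := by positivity
  have hdR : (d.degree : ℝ) ≠ 0 := by positivity
  have hsum : (d.degree : ℝ) = ∑ i, (d i : ℝ) := by rw [Finsupp.degree_eq_sum]; push_cast; rfl
  have hlt : (d.degree : ℝ) < m := by exact_mod_cast hd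
  -- The barycentre of the points `a_i` with weights `d i`.
  have hy := (convex_convexHull ℝ
    (Set.range fun (i : Fin N) (k : Fin n) => (a i.succ k : ℝ))).sum_mem
    (t := Finset.univ) (w := fun i => (d i : ℝ) / d.degree)
    (z := fun (i : Fin N) (k : Fin n) => (a i.succ k : ℝ)) (fun i _ => by positivity)
    (by rw [← Finset.sum_div, ← hsum, div_self hdR])
    (fun i _ => subset_convexHull ℝ _ ⟨i, rfl⟩)
  have key := homothety_mem_intrinsicInterior (convex_convexHull ℝ _) hmem hy
    (r := 1 - (d.degree : ℝ) / m) (by rw [sub_pos, div_lt_one (by positivity)]; exact hlt)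
    (by rw [sub_le_self_iff]; positivity)
  have hau : a 0 + u ∈ interiorLatticePoints a := by
    rw [interiorLatticePoints, Set.mem_ofPred_eq]
    convert! key using 1
    ext k
    have hk : ∑ i, (d i : ℝ) * ((a i.succ k : ℝ) - a 0 k) = m * u k := by
      have := congrFun hu k
      rw [Finsupp.weight_apply, Finsupp.sum_fintype _ _ (by simp)] at this
      simp only [Finset.sum_apply, Pi.smul_apply, nsmul_eq_mul] at this
      exact_mod_cast this
    simp only [mul_sub, Finset.sum_sub_distrib, ← Finset.sum_mul, ← hsum] at hk
    simp only [AffineMap.homothety_apply, vsub_eq_sub, vadd_eq_add, Pi.add_apply, Pi.smul_apply,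
      Pi.sub_apply, Finset.sum_apply, smul_eq_mul, div_mul_eq_mul_div, ← Finset.sum_div, Int.cast_add]
    field_simp
    linear_combination -(d.degree : ℝ) * hk
  rw [ha, Set.mem_singleton_iff] at hau
  simpa using hau

/-! ### Integral polynomials on the unit polydisc -/

section Eval

open MvPolynomial

/-- Evaluation of an integral polynomial at a point of a commutative ring. It is not stated through
`MvPolynomial.aeval` because the two `ℤ`-algebra structures found on `ℂ_[p]`, one of a ring and one
of a completion, do not unify. -/
noncomputable def evalInt {σ K : Type*} [CommRing K] (z : σ → K) : MvPolynomial σ ℤ →+* K :=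
  eval₂Hom (Int.castRingHom K) z

theorem evalInt_X {σ K : Type*} [CommRing K] (z : σ → K) (i : σ) : evalInt z (X i) = z i :=
  eval₂Hom_X' _ _ _

theorem evalInt_C {σ K : Type*} [CommRing K] (z : σ → K) (c : ℤ) : evalInt z (C c) = c :=
  eval₂Hom_C _ _ _

theorem evalInt_expand {σ K : Type*} [CommRing K] (z : σ → K) (p : ℕ) (g : MvPolynomial σ ℤ) :
    evalInt z (expand p g) = evalInt (z ^ p) g := by
  induction g using MvPolynomial.induction_on with
  | C c => rw [expand_C, evalInt_C, evalInt_C]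
  | add f g hf hg => simp only [map_add, hf, hg]
  | mul_X f i hf => simp only [map_mul, hf, expand_X, map_pow, evalInt_X, Pi.pow_apply]

theorem eval_map_castRingHom {σ K : Type*} [CommRing K] (z : σ → K) (g : MvPolynomial σ ℤ) :
    eval z (map (Int.castRingHom K) g) = evalInt z g :=
  eval_map _ _ _

variable {K : Type*} [NormedField K] [IsUltrametricDist K] {σ : Type*}

theorem norm_eq_of_norm_sub_lt {x y : K} (h : ‖x - y‖ < ‖y‖) : ‖x‖ = ‖y‖ := by
  have := IsUltrametricDist.norm_add_eq_max_of_norm_ne_norm h.ne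
  rwa [sub_add_cancel, max_eq_right h.le] at this

theorem norm_evalInt_le_one {z : σ → K} (hz : ∀ i, ‖z i‖ ≤ 1) (g : MvPolynomial σ ℤ) :
    ‖evalInt z g‖ ≤ 1 := by
  induction g using MvPolynomial.induction_on with
  | C c => simpa [evalInt_C] using IsUltrametricDist.norm_intCast_le_one K c
  | add f g hf hg =>
    rw [map_add]
    exact (IsUltrametricDist.norm_add_le_max _ _).trans (max_le hf hg)
  | mul_X f i hf =>
    rw [map_mul, evalInt_X, norm_mul]
    exact mul_le_one₀ hf (norm_nonneg _) (hz i)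

theorem norm_evalInt_sub_constantCoeff_lt {z : σ → K} (hz : ∀ i, ‖z i‖ < 1) (g : MvPolynomial σ ℤ) :
    ‖evalInt z g - ((constantCoeff g : ℤ) : K)‖ < 1 := by
  induction g using MvPolynomial.induction_on with
  | C c => simp
  | add f g hf hg =>
    rw [map_add, map_add, Int.cast_add, add_sub_add_comm]
    exact (IsUltrametricDist.norm_add_le_max _ _).trans_lt (max_lt hf hg)
  | mul_X f i hf =>
    rw [map_mul, evalInt_X, map_mul, constantCoeff_X, mul_zero, Int.cast_zero, sub_zero, norm_mul]
    exact (mul_le_of_le_one_left (norm_nonneg _)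
      (norm_evalInt_le_one (fun i => (hz i).le) f)).trans_lt (hz i)

theorem norm_evalInt_eq_one {z : σ → K} (hz : ∀ i, ‖z i‖ < 1) {g : MvPolynomial σ ℤ}
    (hg : constantCoeff g = 1) : ‖evalInt z g‖ = 1 := by
  have h := norm_evalInt_sub_constantCoeff_lt hz g
  rw [hg, Int.cast_one] at h
  rw [norm_eq_of_norm_sub_lt (y := 1) (by rwa [norm_one]), norm_one]

theorem norm_evalInt_le_of_dvd {p k : ℕ} {z : σ → K} (hz : ∀ i, ‖z i‖ ≤ 1) {g : MvPolynomial σ ℤ}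
    (h : (p : MvPolynomial σ ℤ) ^ k ∣ g) : ‖evalInt z g‖ ≤ ‖(p : K)‖ ^ k := by
  obtain ⟨f, rfl⟩ := h
  rw [map_mul, map_pow, map_natCast, norm_mul, norm_pow]
  exact mul_le_of_le_one_right (by positivity) (norm_evalInt_le_one hz f)

variable {p : ℕ} [Fact p.Prime] {M : Type*} [AddCommGroup M] {w : σ → M}

theorem norm_evalInt_expand_eq_one (hp : ‖(p : K)‖ < 1) {z : σ → K} (hz : ∀ i, ‖z i‖ ≤ 1)
    {g : MvPolynomial σ ℤ} (hg : ‖evalInt z g‖ = 1) : ‖evalInt z (expand p g)‖ = 1 := by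
  have h := norm_evalInt_le_of_dvd (p := p) (k := 1) hz
    (by simpa using natCast_dvd_expand_sub_pow p g)
  rw [map_sub, map_pow, pow_one] at h
  have h1 : ‖evalInt z g ^ p‖ = 1 := by rw [norm_pow, hg, one_pow]
  rw [norm_eq_of_norm_sub_lt (h1 ▸ h.trans_lt hp), h1]

variable [Fintype σ]

/-- Where the first truncation is a unit, so are all the truncations of order `p ^ s`: modulo `p`,
each is the product of the first one and the Frobenius transform of its predecessor. -/
theorem norm_evalInt_truncation_eq_one (hw : ∀ k, WeightSparse w (p ^ k)) (hp : ‖(p : K)‖ < 1)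
    {z : σ → K} (hz : ∀ i, ‖z i‖ ≤ 1) (h1 : ‖evalInt z (truncation w p)‖ = 1) (s : ℕ) :
    ‖evalInt z (truncation w (p ^ s))‖ = 1 := by
  induction s with
  | zero => simp [truncation_one]
  | succ s ih =>
    have h := norm_evalInt_le_of_dvd hz (pow_dvd_dworkMinor_truncation p hw s 0)
    have h2 : ‖evalInt z (truncation w p * expand p (truncation w (p ^ s)))‖ = 1 := by
      rw [map_mul, norm_mul, h1, norm_evalInt_expand_eq_one hp hz ih, one_mul]
    rw [dworkMinor, pow_zero, truncation_one, map_one, mul_one, zero_add, pow_one, map_sub,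
      Nat.min_zero, zero_add, pow_one] at h
    rw [← h2]
    exact norm_eq_of_norm_sub_lt (h2 ▸ h.trans_lt hp)

/-- The Dwork congruences bound the difference of two quotients of truncations. -/
theorem norm_sub_truncation_quotient_le (hw : ∀ k, WeightSparse w (p ^ k)) (hp : ‖(p : K)‖ < 1)
    {z : σ → K} (hz : ∀ i, ‖z i‖ ≤ 1) (h1 : ‖evalInt z (truncation w p)‖ = 1) (s t : ℕ) :
    ‖evalInt z (truncation w (p ^ (s + 1))) / evalInt z (expand p (truncation w (p ^ s))) -
      evalInt z (truncation w (p ^ (t + 1))) / evalInt z (expand p (truncation w (p ^ t)))‖ ≤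
      ‖(p : K)‖ ^ (min s t + 1) := by
  have hQ : ∀ k, ‖evalInt z (expand p (truncation w (p ^ k)))‖ = 1 := fun k =>
    norm_evalInt_expand_eq_one hp hz (norm_evalInt_truncation_eq_one hw hp hz h1 k)
  have h0 : ∀ k, evalInt z (expand p (truncation w (p ^ k))) ≠ 0 := fun k =>
    norm_ne_zero_iff.1 (by rw [hQ]; exact one_ne_zero)
  rw [div_sub_div _ _ (h0 s) (h0 t), norm_div, norm_mul, hQ, hQ, mul_one, div_one]
  have h := norm_evalInt_le_of_dvd hz (pow_dvd_dworkMinor_truncation p hw s t)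
  rw [dworkMinor, map_sub, map_mul, map_mul] at h
  rw [mul_comm (evalInt z (expand p _)) (evalInt z (truncation w (p ^ (t + 1))))]
  exact h

end Eval

/-! ### The hypergeometric series as a limit of truncations -/

section Series

variable {n N : ℕ} (a : Fin (N + 1) → Fin n → ℤ)

/-- The relation in `L_+` with given exponents `l_1, …, l_N`. -/
noncomputable def relationOfExponent (d : Fin N →₀ ℕ) : Fin (N + 1) → ℤ :=
  Fin.cons (-(d.degree : ℤ)) fun i => (d i : ℤ)

/-- The exponent `(l_1, …, l_N)` of a relation `l ∈ L_+`. -/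
noncomputable def exponentOfRelation (l : Fin (N + 1) → ℤ) : Fin N →₀ ℕ :=
  Finsupp.equivFunOnFinite.symm fun i => (l i.succ).toNat

theorem exponentOfRelation_apply (l : Fin (N + 1) → ℤ) (i : Fin N) :
    exponentOfRelation l i = (l i.succ).toNat := rfl

theorem exponentOfRelation_relationOfExponent (d : Fin N →₀ ℕ) :
    exponentOfRelation (relationOfExponent d) = d := by
  ext i
  simp [exponentOfRelation_apply, relationOfExponent]

variable {a}

theorem cast_degree_exponentOfRelation {l : Fin (N + 1) → ℤ} (hl : l ∈ relationsPlus a) :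
    ((exponentOfRelation l).degree : ℤ) = ∑ i : Fin N, l i.succ := by
  rw [Finsupp.degree_eq_sum, Nat.cast_sum]
  exact Finset.sum_congr rfl fun i _ => Int.toNat_of_nonneg (hl.2 i)

theorem relationOfExponent_exponentOfRelation {l : Fin (N + 1) → ℤ} (hl : l ∈ relationsPlus a) :
    relationOfExponent (exponentOfRelation l) = l := by
  ext j
  refine Fin.cases ?_ (fun i => ?_) j
  · rw [relationOfExponent, Fin.cons_zero, cast_degree_exponentOfRelation hl, relations_zero hl.1]
  · rw [relationOfExponent, Fin.cons_succ, exponentOfRelation_apply, Int.toNat_of_nonneg (hl.2 i)]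

theorem relationOfExponent_mem_relationsPlus (d : Fin N →₀ ℕ) :
    relationOfExponent d ∈ relationsPlus a ↔
      Finsupp.weight (fun i : Fin N => a i.succ - a 0) d = 0 := by
  have h1 : ∀ i : Fin N, 0 ≤ relationOfExponent d i.succ := by simp [relationOfExponent]
  have h2 : ∑ j, relationOfExponent d j • hat a j =
      Fin.cons 0 (Finsupp.weight (fun i : Fin N => a i.succ - a 0) d) := by
    rw [Finsupp.weight_apply, Finsupp.sum_fintype _ _ (by simp)]
    ext k
    refine Fin.cases ?_ (fun k => ?_) k
    · simp [Fin.sum_univ_succ, relationOfExponent, hat, Finsupp.degree_eq_sum]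
    · simp [Fin.sum_univ_succ, relationOfExponent, hat, Finsupp.degree_eq_sum, mul_sub,
        Finset.sum_sub_distrib, Finset.sum_mul]
      ring
  have h3 : (Fin.cons 0 (Finsupp.weight (fun i : Fin N => a i.succ - a 0) d) :
      Fin (n + 1) → ℤ) = 0 ↔ Finsupp.weight (fun i : Fin N => a i.succ - a 0) d = 0 := by
    constructor
    · intro h
      ext k
      simpa using congrFun h k.succ
    · intro h
      rw [h]
      ext k
      refine Fin.cases rfl (fun k => rfl) k
  rw [← h3, ← h2]
  exact and_iff_left h1

theorem mem_relationsTrunc_iff {l : Fin (N + 1) → ℤ} (hl : l ∈ relationsPlus a) (m : ℕ) :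
    l ∈ relationsTrunc a m ↔ (exponentOfRelation l).degree < m := by
  have h := cast_degree_exponentOfRelation hl
  refine ⟨fun h' => ?_, fun h' => ⟨hl, ?_⟩⟩
  · have := h'.2
    omega
  · omega

variable {K : Type*} [Field K] [CharZero K]

theorem term_eq_multinomial (l : Fin (N + 1) → ℤ) (lam : Fin (N + 1) → K) :
    term l lam = (((-1) ^ (exponentOfRelation l).degree *
      ((exponentOfRelation l).multinomial : ℤ) : ℤ) : K) *
        ∏ i, ratios lam i ^ exponentOfRelation l i := by
  have h := Nat.multinomial_spec Finset.univ (exponentOfRelation l)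
  have hne : (∏ i : Fin N, ((l i.succ).toNat ! : K)) ≠ 0 :=
    Finset.prod_ne_zero_iff.2 fun i _ => Nat.cast_ne_zero.2 (Nat.factorial_ne_zero _)
  simp only [exponentOfRelation_apply] at h
  rw [term, Finsupp.degree_eq_sum,
    ← Finsupp.multinomial_of_support_subset (Finset.subset_univ _)]
  simp only [exponentOfRelation_apply]
  congr 1
  rw [mul_div_assoc, ← h]
  push_cast
  rw [mul_div_cancel_left₀ _ hne]

theorem evalInt_truncation (m : ℕ) (lam : Fin (N + 1) → K) :
    evalInt (ratios lam) (truncation (fun i : Fin N => a i.succ - a 0) m) =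
      ∑ᶠ l ∈ relationsTrunc a m, term l lam := by
  classical
  rw [finsum_mem_eq_finite_toFinset_sum _ (relationsTrunc_finite a m), evalInt,
    MvPolynomial.coe_eval₂Hom, MvPolynomial.eval₂_eq']
  symm
  refine Finset.sum_bij_ne_zero (fun l _ _ => exponentOfRelation l) (fun l hl h0 => ?_)
    (fun l hl _ l' hl' _ h => ?_) (fun d hd _ => ?_) (fun l hl _ => ?_)
  · rw [Set.Finite.mem_toFinset] at hl
    have hw := (relationOfExponent_mem_relationsPlus (a := a) (exponentOfRelation l)).1
      (by rw [relationOfExponent_exponentOfRelation hl.1]; exact hl.1)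
    rw [MvPolynomial.mem_support_iff, coeff_truncation,
      if_pos ⟨hw, (mem_relationsTrunc_iff hl.1 m).1 hl⟩]
    intro h
    exact h0 (by rw [term_eq_multinomial, h, Int.cast_zero, zero_mul])
  · rw [Set.Finite.mem_toFinset] at hl hl'
    rw [← relationOfExponent_exponentOfRelation hl.1, h,
      relationOfExponent_exponentOfRelation hl'.1]
  · rw [MvPolynomial.mem_support_iff, coeff_truncation, ite_ne_right_iff] at hd
    have hmem := (relationOfExponent_mem_relationsPlus (a := a) d).2 hd.1.1
    have he := exponentOfRelation_relationOfExponent d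
    refine ⟨relationOfExponent d, ?_, ?_, he⟩
    · rw [Set.Finite.mem_toFinset, mem_relationsTrunc_iff hmem, he]
      exact hd.1.2
    · rename_i hne
      rw [coeff_truncation, if_pos hd.1] at hne
      rw [term_eq_multinomial, he]
      exact hne
  · rw [Set.Finite.mem_toFinset] at hl
    have hw := (relationOfExponent_mem_relationsPlus (a := a) (exponentOfRelation l)).1
      (by rw [relationOfExponent_exponentOfRelation hl.1]; exact hl.1)
    rw [coeff_truncation, if_pos ⟨hw, (mem_relationsTrunc_iff hl.1 m).1 hl⟩, term_eq_multinomial]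
    rfl

end Series

section Padic

variable {p : ℕ} [Fact p.Prime] {n N : ℕ} {a : Fin (N + 1) → Fin n → ℤ}

theorem norm_natCast_padicComplex_lt_one : ‖(p : ℂ_[p])‖ < 1 := by
  have h := norm_algebraMap' ℂ_[p] (p : ℚ_[p])
  rw [map_natCast] at h
  rw [h]
  exact Padic.norm_p_lt_one

theorem PhiOne_eq_evalInt (lam : Fin (N + 1) → ℂ_[p]) :
    PhiOne p a lam =
      evalInt (ratios lam) (truncation (fun i : Fin N => a i.succ - a 0) p) :=
  (evalInt_truncation p lam).symm

/-- The terms of the series tend to zero on `𝒟`, since they are integral multiples of monomials in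
the ratios and only finitely many relations have bounded degree. -/
theorem summable_term {lam : Fin (N + 1) → ℂ_[p]} (hlam : lam ∈ domD p N) :
    Summable (fun l : relationsPlus a => term l.1 lam) := by
  apply NonarchimedeanAddGroup.summable_of_tendsto_cofinite_zero
  obtain ⟨r, hr1, hr⟩ : ∃ r : NNReal, r < 1 ∧ ∀ i, ‖ratios lam i‖₊ ≤ r :=
    ⟨Finset.univ.sup fun i => ‖ratios lam i‖₊,
      (Finset.sup_lt_iff one_pos).2 fun i _ => hlam.2 i,
      fun i => Finset.le_sup (f := fun i => ‖ratios lam i‖₊) (Finset.mem_univ i)⟩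
  have hbound : ∀ l : Fin (N + 1) → ℤ,
      ‖term l lam‖ ≤ (r : ℝ) ^ (exponentOfRelation l).degree := by
    intro l
    rw [term_eq_multinomial, norm_mul, norm_prod]
    refine (mul_le_of_le_one_left (by positivity)
      (IsUltrametricDist.norm_intCast_le_one ℂ_[p] _)).trans ?_
    rw [Finsupp.degree_eq_sum, ← Finset.prod_pow_eq_pow_sum]
    refine Finset.prod_le_prod
      (fun i _ => norm_nonneg (ratios lam i ^ exponentOfRelation l i)) fun i _ => ?_
    rw [norm_pow]
    exact pow_le_pow_left₀ (norm_nonneg _) (hr i) _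
  rw [Metric.tendsto_nhds]
  intro ε hε
  obtain ⟨m, hm⟩ := exists_pow_lt_of_lt_one hε hr1
  refine (((relationsTrunc_finite a m).preimage Subtype.val_injective.injOn).subset ?_)
  intro l hl
  by_contra hlt
  rw [Set.mem_preimage, mem_relationsTrunc_iff l.2, not_lt] at hlt
  refine hl ?_
  show dist (term l.1 lam) 0 < ε
  rw [dist_zero_right]
  exact (hbound l.1).trans_lt
    ((pow_le_pow_of_le_one r.coe_nonneg (by exact_mod_cast hr1.le) hlt).trans_lt hm)

theorem tendsto_evalInt_truncation {lam : Fin (N + 1) → ℂ_[p]} (hlam : lam ∈ domD p N) :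
    Tendsto (fun m => evalInt (ratios lam)
      (truncation (fun i : Fin N => a i.succ - a 0) m)) atTop (𝓝 (Phi p a lam)) := by
  classical
  let S : ℕ → Finset (relationsPlus a) := fun m =>
    (relationsTrunc_finite a m).toFinset.subtype (· ∈ relationsPlus a)
  have hmem : ∀ m (l : relationsPlus a), l ∈ S m ↔ (exponentOfRelation l.1).degree < m := by
    intro m l
    rw [Finset.mem_subtype, Set.Finite.mem_toFinset, mem_relationsTrunc_iff l.2]
  have hS : Tendsto S atTop atTop := by
    refine tendsto_atTop_finset_of_monotone (fun m m' h l hl => ?_)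
      fun l => ⟨_, (hmem _ l).2 (Nat.lt_succ_self _)⟩
    rw [hmem] at hl ⊢
    omega
  have h := (summable_term (a := a) hlam).hasSum.comp hS
  refine h.congr fun m => ?_
  rw [evalInt_truncation, finsum_mem_eq_finite_toFinset_sum _ (relationsTrunc_finite a m)]
  exact Finset.sum_subtype_of_mem (fun l => term l lam)
    fun l hl => ((relationsTrunc_finite a m).mem_toFinset.1 hl).1

theorem norm_Phi_eq_one {lam : Fin (N + 1) → ℂ_[p]} (hlam : lam ∈ domD p N) :
    ‖Phi p a lam‖ = 1 := by
  refine tendsto_nhds_unique (tendsto_evalInt_truncation hlam).norm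
    (tendsto_const_nhds.congr' ?_)
  filter_upwards [eventually_ne_atTop 0] with m hm
  exact (norm_evalInt_eq_one hlam.2 (constantCoeff_truncation _ hm)).symm

theorem domD_subset_domDPlus : domD p N ⊆ domDPlus p a := fun lam hlam =>
  ⟨hlam.1, fun i => (hlam.2 i).le, by
    rw [PhiOne_eq_evalInt]
    exact norm_evalInt_eq_one hlam.2 (constantCoeff_truncation _ (Fact.out : p.Prime).ne_zero)⟩

theorem ratios_pow (lam : Fin (N + 1) → ℂ_[p]) (k : ℕ) :
    ratios (fun i => lam i ^ k) = ratios lam ^ k := by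
  ext i
  simp [ratios, div_pow]

theorem pow_mem_domD {lam : Fin (N + 1) → ℂ_[p]} (hlam : lam ∈ domD p N) :
    (fun i => lam i ^ p) ∈ domD p N := by
  refine ⟨pow_ne_zero p hlam.1, fun i => ?_⟩
  rw [ratios_pow, Pi.pow_apply, norm_pow]
  exact pow_lt_one₀ (norm_nonneg _) (hlam.2 i) (Fact.out : p.Prime).ne_zero

end Padic

end AHyp

theorem theorem1p4 (p : ℕ) [Fact p.Prime] (hp : p ≠ 2) (n N : ℕ) (a : Fin (N + 1) → Fin n → ℤ)
    (ha : AHyp.interiorLatticePoints a = {a 0}) :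
    (∀ lam ∈ AHyp.domD p N,
      Summable (fun l : AHyp.relationsPlus a => AHyp.term l.1 lam) ∧ AHyp.Phi p a lam ≠ 0) ∧
    AHyp.domD p N ⊆ AHyp.domDPlus p a ∧
    ∃ f : (Fin (N + 1) → ℂ_[p]) → ℂ_[p],
      AHyp.IsAnalytic p f (AHyp.domDPlus p a) ∧
      ∀ lam ∈ AHyp.domD p N,
        f lam = AHyp.Phi p a lam / AHyp.Phi p a (fun i => lam i ^ p) := by
  have hw : ∀ k, AHyp.WeightSparse (fun i : Fin N => a i.succ - a 0) (p ^ k) := fun k =>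
    AHyp.weightSparse_of_interiorLatticePoints ha _
  have hp1 : ‖(p : ℂ_[p])‖ < 1 := AHyp.norm_natCast_padicComplex_lt_one
  have hPhi : ∀ lam ∈ AHyp.domD p N, AHyp.Phi p a lam ≠ 0 := fun lam hlam =>
    norm_ne_zero_iff.1 (by rw [AHyp.norm_Phi_eq_one hlam]; exact one_ne_zero)
  refine ⟨fun lam hlam => ⟨AHyp.summable_term hlam, hPhi lam hlam⟩, AHyp.domD_subset_domDPlus, ?_⟩
  set F : ℕ → MvPolynomial (Fin N) ℤ :=
    fun k => AHyp.truncation (fun i : Fin N => a i.succ - a 0) (p ^ k) with hF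
  have hunit : ∀ lam ∈ AHyp.domDPlus p a,
      ‖AHyp.evalInt (AHyp.ratios lam)
        (AHyp.truncation (fun i : Fin N => a i.succ - a 0) p)‖ = 1 := fun lam hlam => by
    rw [← AHyp.PhiOne_eq_evalInt]
    exact hlam.2.2
  let G : ℕ → (Fin (N + 1) → ℂ_[p]) → ℂ_[p] := fun k lam =>
    AHyp.evalInt (AHyp.ratios lam) (F (k + 1)) /
      AHyp.evalInt (AHyp.ratios lam) (MvPolynomial.expand p (F k))
  have hG : UniformCauchySeqOn G atTop (AHyp.domDPlus p a) := by
    rw [Metric.uniformCauchySeqOn_iff]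
    intro ε hε
    obtain ⟨k, hk⟩ := exists_pow_lt_of_lt_one hε hp1
    refine ⟨k, fun s hs t ht lam hlam => ?_⟩
    rw [dist_eq_norm]
    refine ((AHyp.norm_sub_truncation_quotient_le hw hp1 hlam.2.1 (hunit lam hlam) s t).trans
      (pow_le_pow_of_le_one (norm_nonneg _) hp1.le ?_)).trans_lt hk
    omega
  choose! f hf using fun lam (hlam : lam ∈ AHyp.domDPlus p a) =>
    cauchySeq_tendsto_of_complete (hG.cauchySeq hlam)
  refine ⟨f, ⟨fun k => MvPolynomial.map (Int.castRingHom ℂ_[p]) (F (k + 1)),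
    fun k => MvPolynomial.map (Int.castRingHom ℂ_[p]) (MvPolynomial.expand p (F k)),
    fun k lam hlam => ?_, ?_⟩, fun lam hlam => ?_⟩
  · rw [AHyp.eval_map_castRingHom, ← norm_ne_zero_iff, AHyp.norm_evalInt_expand_eq_one hp1 hlam.2.1
      (AHyp.norm_evalInt_truncation_eq_one hw hp1 hlam.2.1 (hunit lam hlam) k)]
    exact one_ne_zero
  · simp only [AHyp.eval_map_castRingHom]
    exact hG.tendstoUniformlyOn_of_tendsto hf
  · have hpow : Tendsto (fun k => p ^ k) atTop atTop :=
      tendsto_pow_atTop_atTop_of_one_lt (Fact.out : p.Prime).one_lt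
    have hlam' := AHyp.pow_mem_domD hlam
    have h1 := ((AHyp.tendsto_evalInt_truncation (a := a) hlam).comp hpow).comp
      (tendsto_add_atTop_nat 1)
    have h2 := (AHyp.tendsto_evalInt_truncation (a := a) hlam').comp hpow
    refine tendsto_nhds_unique (hf lam (AHyp.domD_subset_domDPlus hlam)) ?_
    refine (h1.div h2 (hPhi _ hlam')).congr fun k => ?_
    simp only [Function.comp_apply, G, hF, AHyp.evalInt_expand, AHyp.ratios_pow, Pi.div_apply]
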